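/- Let $n\in\mathbb N$, let $A\in\mathbb R^{n\times n}$ be Hurwitz, $B\in\mathbb R^n$, let $Q=Q^{\mathsf T}\succ0$, let $P=P^{\mathsf T}\succ 0$ satisfy $A^{\mathsf T}P+PA=-Q$, and put $C=PB$. Let $r:[0,\infty)\to\mathbb R$ be piecewise continuous (finitely many discontinuities in every bounded interval, finite one-sided limits) and bounded, and let $x_m:[0,\infty)\to\mathbb R^n$ be a solution of the reference model $\dot x_m(t)=Ax_m(t)+Br(t)$ (continuous, satisfying the equation at the points of continuity of $r$). Suppose that $x_m$ is bounded and persistently exciting: there are $T>0$ and $\alpha>0$ with $$\int_t^{t+T}x_m(\tau)x_m^{\mathsf T}(\tau)\,d\tau\succeq\alpha I\qquad\text{for all }t\ge 0 .$$ Consider the model reference adaptive control error dynamics for $z=[e^{\mathsf T},\phi^{\mathsf T}]^{\mathsf T}\in\mathbb R^{2n}$, $$\dot z(t)=\begin{bmatrix}A & Bx^{\mathsf T}(t)\\ -x(t)C^{\mathsf T} & 0\end{bmatrix}z(t),\qquad x(t)=x_m(t)+e(t).$$ Then $z=0$ is an equilibrium, for every $t_0\ge0$ and $z_0\in\mathbb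 R^{2n}$ there is a unique solution $s(t;z_0,t_0)$, $t\ge t_0$, with $s(t_0;z_0,t_0)=z_0$, and the equilibrium is uniformly asymptotically stable in the large (UASL); that is, in the Euclidean norm, 1. (uniformly stable) for every $\epsilon>0$ there is $\delta>0$ such that $\|z_0\|\le\delta$ implies $\|s(t;z_0,t_0)\|\le\epsilon$ for all $t_0\ge0$ and $t\ge t_0$; 2. (uniformly bounded) for every $\rho>0$ there is $b$ such that $\|z_0\|\le\rho$ implies $\|s(t;z_0,t_0)\|\le b$ for all $t_0\ge0$ and $t\ge t_0$; 3. (uniformly attracting in the large) for all $\rho>0$ and $\eta>0$ there is $T'\ge0$ such that $\|z_0\|\le\rho$ implies $\|s(t;z_0,t_0)\|\le\eta$ for all $t_0\ge0$ and $t\ge t_0+T'$. -/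

import Mathlib

open Set Filter Topology

/-! ### Stability of the equilibrium `0` of `x' = f(x, t)`, `t ≥ t₀ ≥ 0` -/

/-- `s` is a solution on `[t₀, ∞)` of `s' = f(s, t)` with `s(t₀) = x₀`
(the derivative at `t₀` is the right derivative). -/
def IsSolutionFrom {E : Type*} [NormedAddCommGroup E] [NormedSpace ℝ E]
    (f : E → ℝ → E) (t₀ : ℝ) (x₀ : E) (s : ℝ → E) : Prop :=
  s t₀ = x₀ ∧ ∀ t ∈ Ici t₀, HasDerivWithinAt s (f (s t) t) (Ici t₀) t

/-- The transition function `s(t; x₀, t₀)` exists and is unique: for every initial time `t₀ ≥ 0`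
and every initial state there is exactly one solution on `[t₀, ∞)`. -/
def HasTransitionFunction {E : Type*} [NormedAddCommGroup E] [NormedSpace ℝ E]
    (f : E → ℝ → E) : Prop :=
  ∀ t₀ : ℝ, 0 ≤ t₀ → ∀ x₀ : E, ∃ s : ℝ → E, IsSolutionFrom f t₀ x₀ s ∧
    ∀ s' : ℝ → E, IsSolutionFrom f t₀ x₀ s' → EqOn s' s (Ici t₀)

/-- `0` is an equilibrium of `x' = f(x, t)`. -/
def IsEquilibriumZero {E : Type*} [NormedAddCommGroup E] (f : E → ℝ → E) : Prop :=
  ∀ t : ℝ, 0 ≤ t → f 0 t = 0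

def UniformlyStable {E : Type*} [NormedAddCommGroup E] [NormedSpace ℝ E]
    (f : E → ℝ → E) : Prop :=
  ∀ ε : ℝ, 0 < ε → ∃ δ : ℝ, 0 < δ ∧ ∀ t₀ : ℝ, 0 ≤ t₀ → ∀ (x₀ : E) (s : ℝ → E),
    IsSolutionFrom f t₀ x₀ s → ‖x₀‖ ≤ δ → ∀ t : ℝ, t₀ ≤ t → ‖s t‖ ≤ ε

def UniformlyBounded {E : Type*} [NormedAddCommGroup E] [NormedSpace ℝ E]
    (f : E → ℝ → E) : Prop :=
  ∀ ρ : ℝ, 0 < ρ → ∃ b : ℝ, ∀ t₀ : ℝ, 0 ≤ t₀ → ∀ (x₀ : E) (s : ℝ → E),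
    IsSolutionFrom f t₀ x₀ s → ‖x₀‖ ≤ ρ → ∀ t : ℝ, t₀ ≤ t → ‖s t‖ ≤ b

def UniformlyAttractingInTheLarge {E : Type*} [NormedAddCommGroup E] [NormedSpace ℝ E]
    (f : E → ℝ → E) : Prop :=
  ∀ ρ : ℝ, 0 < ρ → ∀ η : ℝ, 0 < η → ∃ T : ℝ, 0 ≤ T ∧ ∀ t₀ : ℝ, 0 ≤ t₀ →
    ∀ (x₀ : E) (s : ℝ → E), IsSolutionFrom f t₀ x₀ s → ‖x₀‖ ≤ ρ →
      ∀ t : ℝ, t₀ + T ≤ t → ‖s t‖ ≤ η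

/-- The equilibrium `0` is uniformly asymptotically stable in the large. -/
def IsUASL {E : Type*} [NormedAddCommGroup E] [NormedSpace ℝ E] (f : E → ℝ → E) : Prop :=
  UniformlyStable f ∧ UniformlyBounded f ∧ UniformlyAttractingInTheLarge f

/-! ### Signals on `[0, ∞)` -/

/-- Piecewise continuity on `[0, ∞)`: finitely many discontinuities in every bounded interval,
and finite one-sided limits everywhere. -/
def PiecewiseContinuous (r : ℝ → ℝ) : Prop :=
  (∀ b : ℝ, {t : ℝ | t ∈ Icc 0 b ∧ ¬ ContinuousWithinAt r (Ici 0) t}.Finite) ∧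
  (∀ t : ℝ, 0 ≤ t → ∃ l : ℝ, Tendsto r (𝓝[>] t) (𝓝 l)) ∧
  (∀ t : ℝ, 0 < t → ∃ l : ℝ, Tendsto r (𝓝[<] t) (𝓝 l))

/-- Boundedness on `[0, ∞)`. -/
def BoundedSignal {E : Type*} [NormedAddCommGroup E] (y : ℝ → E) : Prop :=
  ∃ β : ℝ, ∀ t : ℝ, 0 ≤ t → ‖y t‖ ≤ β

/-- The matrix `∫ₜ^{t+T} y(τ) y(τ)ᵀ dτ`. -/
noncomputable def excitationMatrix {n : ℕ} (y : ℝ → EuclideanSpace ℝ (Fin n)) (t T : ℝ) :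
    Matrix (Fin n) (Fin n) ℝ :=
  Matrix.of fun i j => ∫ τ in t..(t + T), y τ i * y τ j

/-- Persistent excitation on `[0, ∞)`: `∫ₜ^{t+T} y yᵀ dτ ⪰ α I` for all `t ≥ 0`. -/
def PersistentlyExciting {n : ℕ} (y : ℝ → EuclideanSpace ℝ (Fin n)) : Prop :=
  ∃ T : ℝ, 0 < T ∧ ∃ α : ℝ, 0 < α ∧ ∀ t : ℝ, 0 ≤ t →
    (excitationMatrix y t T - α • (1 : Matrix (Fin n) (Fin n) ℝ)).PosSemidef

/-! ### Model reference adaptive control -/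

/-- All complex eigenvalues have negative real part. -/
def IsHurwitz {n : ℕ} (A : Matrix (Fin n) (Fin n) ℝ) : Prop :=
  ∀ μ ∈ spectrum ℂ (A.map Complex.ofReal), μ.re < 0

/-- `x_m` solves `x_m' = A x_m + B r` on `[0, ∞)` for a piecewise continuous `r`: it is continuous
and satisfies the equation at every time at which `r` is continuous. -/
def IsReferenceState {n : ℕ} (A : Matrix (Fin n) (Fin n) ℝ) (B : Fin n → ℝ)
    (r : ℝ → ℝ) (xm : ℝ → EuclideanSpace ℝ (Fin n)) : Prop :=
  ContinuousOn xm (Ici 0) ∧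
  ∀ t : ℝ, 0 ≤ t → ContinuousWithinAt r (Ici 0) t →
    HasDerivWithinAt xm (WithLp.toLp 2 (A.mulVec (xm t) + r t • B)) (Ici 0) t

/-- The plant state `x = x_m + e` as a function of time and of `z = (e, φ)`. -/
def plantState {n : ℕ} (xm : ℝ → EuclideanSpace ℝ (Fin n))
    (z : EuclideanSpace ℝ (Fin n ⊕ Fin n)) (t : ℝ) : Fin n → ℝ :=
  fun i => xm t i + z (Sum.inl i)

/-- The right-hand side `[[A, B xᵀ], [-x Cᵀ, 0]] z` of the error dynamics, where `z = (e, φ)`,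
`x = x_m(t) + e` and `C = P B`. -/
noncomputable def errorField {n : ℕ} (A P : Matrix (Fin n) (Fin n) ℝ) (B : Fin n → ℝ)
    (xm : ℝ → EuclideanSpace ℝ (Fin n)) (z : EuclideanSpace ℝ (Fin n ⊕ Fin n)) (t : ℝ) :
    EuclideanSpace ℝ (Fin n ⊕ Fin n) :=
  WithLp.toLp 2 ((Matrix.fromBlocks A (Matrix.vecMulVec B (plantState xm z t))
    (-(Matrix.vecMulVec (plantState xm z t) (P.mulVec B))) 0).mulVec z)

/-!
With `C = P B` the plant state cancels from the derivative of `V = eᵀ P e + ‖φ‖²` along the error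
dynamics, leaving `V' = -eᵀ Q e`. So `V` bounds every solution in terms of its initial state, and it
can pay for only boundedly many windows in which `e` is not small, `e` being Lipschitz: within a
uniform time there is a window on which `e` is small throughout. By Landau's inequality `e'` is
small there too, so the error equation makes `B xᵀ φ` small, hence `x_mᵀ φ`, as `B ≠ 0`. But `φ`
moves slowly while `e` is small, so `x_mᵀ φ` stays small with `φ` frozen at the start of the window,
and persistent excitation makes that `φ` small. From then on `V` keeps the state small.

That `B ≠ 0` follows from the same window argument: without input, `x_mᵀ P x_m` would force `x_m`
to be small over a whole window, contradicting persistent excitation.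
-/

open scoped NNReal RealInnerProductSpace

section DifferentialInequalities

variable {E : Type*} [NormedAddCommGroup E] [NormedSpace ℝ E]

theorem image_le_sub_mul_of_deriv_right_le {u u' : ℝ → ℝ} {a b c : ℝ} (hab : a ≤ b)
    (hu : ContinuousOn u (Icc a b)) (hu' : ∀ t ∈ Ico a b, HasDerivWithinAt u (u' t) (Ici t) t)
    (hc : ∀ t ∈ Ico a b, u' t ≤ -c) : u b ≤ u a - c * (b - a) := by
  have hline : ∀ t, HasDerivAt (fun t => u a - c * (t - a)) (-c) t := fun t => by
    simpa using (((hasDerivAt_id t).sub_const a).const_mul c).const_sub (u a)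
  exact image_le_of_deriv_right_le_deriv_boundary hu hu' (B := fun t => u a - c * (t - a))
    (by simp) (fun t _ => (hline t).continuousAt.continuousWithinAt)
    (fun t _ => (hline t).hasDerivWithinAt) hc (right_mem_Icc.2 hab)

/- Landau's inequality: by the mean value inequality for `y t - (t - a) • y' a`, the vector
`h • y' a` differs from `y (a + h) - y a` by at most `K h²`. -/
theorem norm_deriv_le_of_norm_le_of_lipschitzOnWith {y y' : ℝ → E} {a h ε : ℝ} {K : ℝ≥0}
    (hh : 0 < h)
    (hy : ∀ t ∈ Icc a (a + h), HasDerivWithinAt y (y' t) (Icc a (a + h)) t)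
    (hy' : LipschitzOnWith K y' (Icc a (a + h))) (hε : ∀ t ∈ Icc a (a + h), ‖y t‖ ≤ ε) :
    ‖y' a‖ ≤ 2 * ε / h + K * h := by
  have ha : a ∈ Icc a (a + h) := left_mem_Icc.2 (by linarith)
  have hah : a + h ∈ Icc a (a + h) := right_mem_Icc.2 (by linarith)
  have hremainder : ‖y (a + h) - h • y' a - y a‖ ≤ K * h * h := by
    have := norm_image_sub_le_of_norm_deriv_le_segment' (C := K * h)
      (f := fun t => y t - (t - a) • y' a) (f' := fun t => y' t - y' a)
      (fun t ht => by
        simpa using (hy t ht).fun_sub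
          (((hasDerivAt_id t).sub_const a).smul_const (y' a)).hasDerivWithinAt)
      (fun t ht => by
        refine (hy'.norm_sub_le (Ico_subset_Icc_self ht) ha).trans ?_
        rw [Real.norm_of_nonneg (sub_nonneg.2 ht.1)]
        gcongr
        linarith [ht.2]) _ hah
    simpa using this
  have hmul : ‖h • y' a‖ ≤ 2 * ε + K * h * h := by
    calc ‖h • y' a‖ = ‖(y (a + h) - y a) - (y (a + h) - h • y' a - y a)‖ := by congr 1; abel
      _ ≤ ‖y (a + h) - y a‖ + ‖y (a + h) - h • y' a - y a‖ := norm_sub_le _ _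
      _ ≤ ‖y (a + h)‖ + ‖y a‖ + K * h * h := add_le_add (norm_sub_le _ _) hremainder
      _ ≤ 2 * ε + K * h * h := by linarith [hε _ ha, hε _ hah]
  rw [norm_smul, Real.norm_of_nonneg hh.le] at hmul
  calc ‖y' a‖ ≤ (2 * ε + K * h * h) / h := by rwa [le_div_iff₀' hh]
    _ = 2 * ε / h + K * h := by field_simp

end DifferentialInequalities

/-- `u` is a nonnegative storage function on `[t₀, ∞)`, dissipated at rate at least `q ‖y‖²` by the
`M`-Lipschitz signal `y`. Only a right derivative of `u` is required. -/
structure IsDissipatedBy {E : Type*} [NormedAddCommGroup E] (q : ℝ) (M : ℝ≥0) (t₀ : ℝ)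
    (u : ℝ → ℝ) (y : ℝ → E) : Prop where
  nonneg : ∀ t ∈ Ici t₀, 0 ≤ u t
  continuousOn : ContinuousOn u (Ici t₀)
  exists_deriv_le : ∀ t ∈ Ici t₀, ∃ u', HasDerivWithinAt u u' (Ici t) t ∧ u' ≤ -(q * ‖y t‖ ^ 2)
  lipschitzOnWith : LipschitzOnWith M y (Ici t₀)

namespace IsDissipatedBy

variable {E : Type*} [NormedAddCommGroup E] {q t₀ a ε L : ℝ} {M : ℝ≥0} {u : ℝ → ℝ} {y : ℝ → E}

theorem le_sub_mul_of_forall_le_norm (h : IsDissipatedBy q M t₀ u y) (hq : 0 ≤ q) (hε : 0 ≤ ε)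
    {b : ℝ} (ha : t₀ ≤ a) (hab : a ≤ b) (hy : ∀ t ∈ Ico a b, ε ≤ ‖y t‖) :
    u b ≤ u a - q * ε ^ 2 * (b - a) := by
  choose! u' hu' hle using h.exists_deriv_le
  refine image_le_sub_mul_of_deriv_right_le hab
    (h.continuousOn.mono fun t ht => ha.trans ht.1) (fun t ht => hu' t (ha.trans ht.1))
    fun t ht => (hle t (ha.trans ht.1)).trans ?_
  have := hy t ht
  gcongr

theorem antitoneOn (h : IsDissipatedBy q M t₀ u y) (hq : 0 ≤ q) : AntitoneOn u (Ici t₀) :=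
  fun a ha b _ hab => by
    simpa using h.le_sub_mul_of_forall_le_norm hq le_rfl ha hab fun t _ => norm_nonneg (y t)

theorem le_sub_of_le_norm (h : IsDissipatedBy q M t₀ u y) (hq : 0 ≤ q) (hε : 0 ≤ ε)
    (ha : t₀ ≤ a) (hy : ε ≤ ‖y a‖) :
    u (a + ε / (2 * (M + 1))) ≤ u a - q * (ε / 2) ^ 2 * (ε / (2 * (M + 1))) := by
  set d := ε / (2 * (M + 1)) with hd
  have hd0 : 0 ≤ d := by positivity
  have hMd : M * d ≤ ε / 2 := by
    rw [hd, mul_div_assoc', div_le_iff₀ (by positivity)]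
    nlinarith
  have hhalf : ∀ t ∈ Ico a (a + d), ε / 2 ≤ ‖y t‖ := fun t ht => by
    have hmove : ‖y a - y t‖ ≤ M * d := by
      refine (h.lipschitzOnWith.norm_sub_le ha (ha.trans ht.1)).trans ?_
      rw [norm_sub_rev, Real.norm_of_nonneg (sub_nonneg.2 ht.1)]
      gcongr
      linarith [ht.2]
    linarith [norm_sub_norm_le (y a) (y t)]
  simpa using h.le_sub_mul_of_forall_le_norm hq (by positivity : 0 ≤ ε / 2) ha
    (le_add_of_nonneg_right hd0) hhalf

theorem le_sub_of_exists_le_norm (h : IsDissipatedBy q M t₀ u y) (hq : 0 ≤ q) (hε : 0 ≤ ε)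
    (ha : t₀ ≤ a) (hy : ∃ t ∈ Icc a (a + L), ε ≤ ‖y t‖) :
    u (a + (L + ε / (2 * (M + 1)))) ≤ u a - q * (ε / 2) ^ 2 * (ε / (2 * (M + 1))) := by
  obtain ⟨t, ht, hyt⟩ := hy
  have hd : 0 ≤ ε / (2 * (M + 1)) := by positivity
  have ht₀ : t₀ ≤ t := ha.trans ht.1
  have hafter : u (a + (L + ε / (2 * (M + 1)))) ≤ u (t + ε / (2 * (M + 1))) :=
    h.antitoneOn hq (mem_Ici.2 (by linarith)) (mem_Ici.2 (by linarith [ht.1, ht.2]))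
      (by linarith [ht.2])
  have hbefore : u t ≤ u a := h.antitoneOn hq ha ht₀ ht.1
  linarith [h.le_sub_of_le_norm hq hε ht₀ hyt]

theorem exists_window_forall_norm_lt (hq : 0 < q) (hε : 0 < ε) (hL : 0 ≤ L) (M : ℝ≥0) (U : ℝ) :
    ∃ T, 0 ≤ T ∧ ∀ (t₀ : ℝ) (u : ℝ → ℝ) (y : ℝ → E), IsDissipatedBy q M t₀ u y → u t₀ ≤ U →
      ∃ a ∈ Icc t₀ (t₀ + T), ∀ t ∈ Icc a (a + L), ‖y t‖ < ε := by
  set W := L + ε / (2 * (M + 1))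
  set c := q * (ε / 2) ^ 2 * (ε / (2 * (M + 1)))
  have hW : 0 ≤ W := by positivity
  have hc : 0 < c := by positivity
  obtain ⟨N, hN⟩ := exists_nat_gt (U / c)
  refine ⟨N * W, mul_nonneg N.cast_nonneg hW, fun t₀ u y h hU => ?_⟩
  by_contra! hlarge
  have hdrop : ∀ k ≤ N, u (t₀ + k * W) ≤ u t₀ - k * c := by
    intro k
    induction k with
    | zero => simp
    | succ k ih =>
      intro hk
      have hkN : (k : ℝ) ≤ N := by exact_mod_cast Nat.le_of_succ_le hk
      have hk₀ : t₀ ≤ t₀ + k * W := le_add_of_nonneg_right (by positivity)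
      have hstep : u (t₀ + k * W + W) ≤ u (t₀ + k * W) - c :=
        h.le_sub_of_exists_le_norm hq.le hε.le hk₀ (hlarge _ ⟨hk₀, by gcongr⟩)
      rw [show t₀ + ((k + 1 : ℕ) : ℝ) * W = t₀ + k * W + W by push_cast; ring]
      push_cast
      linarith [ih (Nat.le_of_succ_le hk)]
  have hnonneg := h.nonneg (t₀ + N * W) (mem_Ici.2 (le_add_of_nonneg_right (by positivity)))
  rw [div_lt_iff₀ hc] at hN
  linarith [hdrop N le_rfl]

end IsDissipatedBy

section BoundedSets

variable {E : Type*} [NormedAddCommGroup E]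

/-- `f` is Lipschitz on bounded sets of states, uniformly in the time `t ≥ 0`. -/
def LipschitzOnBounded (f : E → ℝ → E) : Prop :=
  ∀ R : ℝ, ∃ K : ℝ≥0, ∀ t, 0 ≤ t → LipschitzOnWith K (fun z => f z t) (Metric.closedBall 0 R)

theorem LipschitzOnBounded.exists_norm_le {f : E → ℝ → E} (hf : LipschitzOnBounded f)
    (hf0 : IsEquilibriumZero f) (R : ℝ) :
    ∃ C : ℝ≥0, ∀ t, 0 ≤ t → ∀ z, ‖z‖ ≤ R → ‖f z t‖ ≤ C := by
  obtain ⟨K, hK⟩ := hf R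
  refine ⟨K * R.toNNReal, fun t ht z hz => ?_⟩
  have hR : 0 ≤ R := (norm_nonneg z).trans hz
  have := (hK t ht).norm_sub_le (x := z) (y := 0) (by simpa using hz) (by simpa using hR)
  rw [hf0 t ht, sub_zero, sub_zero] at this
  rw [NNReal.coe_mul, Real.coe_toNNReal R hR]
  exact this.trans (by gcongr)

/-- The continuous cutoff equal to `1` on the ball of radius `R` and to `0` off the ball of radius
`R + 1`. It turns a field that is Lipschitz on bounded sets into a bounded one. -/
noncomputable def ballCutoff (R : ℝ) (z : E) : ℝ := max 0 (min 1 (R + 1 - ‖z‖))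

theorem ballCutoff_nonneg (R : ℝ) (z : E) : 0 ≤ ballCutoff R z := le_max_left _ _

theorem ballCutoff_le_one (R : ℝ) (z : E) : ballCutoff R z ≤ 1 :=
  max_le zero_le_one (min_le_left _ _)

theorem ballCutoff_eq_one {R : ℝ} {z : E} (h : ‖z‖ ≤ R) : ballCutoff R z = 1 := by
  rw [ballCutoff, min_eq_left (by linarith), max_eq_right zero_le_one]

theorem ballCutoff_eq_zero {R : ℝ} {z : E} (h : R + 1 ≤ ‖z‖) : ballCutoff R z = 0 :=
  max_eq_left ((min_le_right _ _).trans (by linarith))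

theorem lipschitzWith_ballCutoff (R : ℝ) : LipschitzWith 1 (ballCutoff R : E → ℝ) := by
  have : LipschitzWith 1 fun z : E => R + 1 - ‖z‖ := by
    simpa using (LipschitzWith.const (R + 1)).sub lipschitzWith_one_norm
  exact (this.const_min 1).const_max 0

end BoundedSets

section Solutions

variable {E : Type*} [NormedAddCommGroup E] [NormedSpace ℝ E] {f : E → ℝ → E} {t₀ : ℝ} {x₀ : E}
  {s : ℝ → E}

namespace IsSolutionFrom

theorem continuousOn (hs : IsSolutionFrom f t₀ x₀ s) : ContinuousOn s (Ici t₀) :=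
  fun t ht => (hs.2 t ht).continuousWithinAt

theorem hasDerivWithinAt_Icc (hs : IsSolutionFrom f t₀ x₀ s) {a b t : ℝ} (ha : t₀ ≤ a)
    (ht : t ∈ Icc a b) : HasDerivWithinAt s (f (s t) t) (Icc a b) t :=
  (hs.2 t (ha.trans ht.1)).mono fun _ hτ => ha.trans hτ.1

theorem restart (hs : IsSolutionFrom f t₀ x₀ s) {a : ℝ} (ha : t₀ ≤ a) :
    IsSolutionFrom f a (s a) s :=
  ⟨rfl, fun t ht => (hs.2 t (ha.trans ht)).mono (Ici_subset_Ici.2 ha)⟩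

theorem lipschitzOnWith (hs : IsSolutionFrom f t₀ x₀ s) {C : ℝ≥0}
    (hC : ∀ t ∈ Ici t₀, ‖f (s t) t‖ ≤ C) : LipschitzOnWith C s (Ici t₀) :=
  (convex_Ici t₀).lipschitzOnWith_of_nnnorm_hasDerivWithin_le hs.2 hC

end IsSolutionFrom

theorem norm_ballCutoff_smul_le (R : ℝ) (z v : E) : ‖ballCutoff R z • v‖ ≤ ‖v‖ := by
  rw [norm_smul, Real.norm_of_nonneg (ballCutoff_nonneg R z)]
  exact mul_le_of_le_one_left (norm_nonneg v) (ballCutoff_le_one R z)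

namespace LipschitzOnBounded

theorem eqOn_Icc (hf : LipschitzOnBounded f) {a b : ℝ} (ha : 0 ≤ a) {s s' : ℝ → E}
    (hs : ∀ t ∈ Icc a b, HasDerivWithinAt s (f (s t) t) (Icc a b) t)
    (hs' : ∀ t ∈ Icc a b, HasDerivWithinAt s' (f (s' t) t) (Icc a b) t) (h : s a = s' a) :
    EqOn s s' (Icc a b) := by
  have hsc : ContinuousOn s (Icc a b) := fun t ht => (hs t ht).continuousWithinAt
  have hsc' : ContinuousOn s' (Icc a b) := fun t ht => (hs' t ht).continuousWithinAt
  obtain ⟨C, hC⟩ := isCompact_Icc.exists_bound_of_continuousOn hsc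
  obtain ⟨C', hC'⟩ := isCompact_Icc.exists_bound_of_continuousOn hsc'
  obtain ⟨K, hK⟩ := hf (max C C')
  refine ODE_solution_unique_of_mem_Icc_right (v := fun t z => f z t)
    (s := fun _ => Metric.closedBall 0 (max C C')) (fun t ht => hK t (ha.trans ht.1))
    hsc (fun t ht => (hs t (Ico_subset_Icc_self ht)).mono_of_mem_nhdsWithin
      (Icc_mem_nhdsGE_of_mem ht)) (fun t ht => ?_)
    hsc' (fun t ht => (hs' t (Ico_subset_Icc_self ht)).mono_of_mem_nhdsWithin
      (Icc_mem_nhdsGE_of_mem ht)) (fun t ht => ?_) h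
  · simpa using Or.inl (hC t (Ico_subset_Icc_self ht))
  · simpa using Or.inr (hC' t (Ico_subset_Icc_self ht))

theorem eqOn_Ici (hf : LipschitzOnBounded f) (ht₀ : 0 ≤ t₀) {s' : ℝ → E}
    (hs : IsSolutionFrom f t₀ x₀ s) (hs' : IsSolutionFrom f t₀ x₀ s') : EqOn s s' (Ici t₀) :=
  fun _ ht => hf.eqOn_Icc ht₀ (fun _ => hs.hasDerivWithinAt_Icc le_rfl)
    (fun _ => hs'.hasDerivWithinAt_Icc le_rfl) (hs.1.trans hs'.1.symm) (right_mem_Icc.2 ht)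

theorem exists_isSolutionFrom_of_forall_Icc (hf : LipschitzOnBounded f) (ht₀ : 0 ≤ t₀)
    (h : ∀ N : ℕ, ∃ s : ℝ → E, s t₀ = x₀ ∧
      ∀ t ∈ Icc t₀ (t₀ + N), HasDerivWithinAt s (f (s t) t) (Icc t₀ (t₀ + N)) t) :
    ∃ s, IsSolutionFrom f t₀ x₀ s := by
  choose σ hσ0 hσ using h
  have hagree : ∀ M N : ℕ, M ≤ N → EqOn (σ M) (σ N) (Icc t₀ (t₀ + M)) := fun M N hMN => by
    have hsub : Icc t₀ (t₀ + M) ⊆ Icc t₀ (t₀ + N) := Icc_subset_Icc_right (by gcongr)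
    exact hf.eqOn_Icc ht₀ (hσ M) (fun t ht => (hσ N t (hsub ht)).mono hsub)
      ((hσ0 M).trans (hσ0 N).symm)
  let s : ℝ → E := fun t => σ ⌈t - t₀⌉₊ t
  have hs : ∀ N : ℕ, EqOn s (σ N) (Icc t₀ (t₀ + N)) := fun N t ht =>
    hagree _ N (Nat.ceil_le.2 (by linarith [ht.2])) ⟨ht.1, by linarith [Nat.le_ceil (t - t₀)]⟩
  refine ⟨s, by simp [s, hσ0], fun t ht => ?_⟩
  obtain ⟨N, hN⟩ := exists_nat_gt (t - t₀)
  have htN : t < t₀ + N := by linarith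
  have hmem : t ∈ Icc t₀ (t₀ + N) := ⟨ht, htN.le⟩
  have hder := (hσ N t hmem).congr (hs N) (hs N hmem)
  rw [← hs N hmem] at hder
  refine hder.mono_of_mem_nhdsWithin ?_
  rw [← Ici_inter_Iic]
  exact inter_mem_nhdsWithin _ (Iic_mem_nhds htN)

theorem exists_isSolutionFrom_of_norm_le [CompleteSpace E] (hf : LipschitzOnBounded f)
    (hcont : ∀ z, ContinuousOn (f z) (Ici 0)) {C : ℝ≥0} (hC : ∀ t, 0 ≤ t → ∀ z, ‖f z t‖ ≤ C)
    (ht₀ : 0 ≤ t₀) (x₀ : E) : ∃ s, IsSolutionFrom f t₀ x₀ s := by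
  refine hf.exists_isSolutionFrom_of_forall_Icc ht₀ fun N => ?_
  have hnonneg : ∀ t ∈ Icc t₀ (t₀ + N), 0 ≤ t := fun t ht => ht₀.trans ht.1
  have ht₀N : t₀ ≤ t₀ + N := by simp
  obtain ⟨K, hK⟩ := hf ((C * N : ℝ≥0) + dist x₀ 0)
  have hPicard : IsPicardLindelof (fun t z => f z t) (⟨t₀, left_mem_Icc.2 ht₀N⟩ :
      Icc t₀ (t₀ + N)) x₀ (C * N) 0 C K :=
    { lipschitzOnWith := fun t ht =>
        (hK t (hnonneg t ht)).mono (Metric.closedBall_subset_closedBall' le_rfl)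
      continuousOn := fun z _ => (hcont z).mono hnonneg
      norm_le := fun t ht z _ => hC t (hnonneg t ht) z
      mul_max_le := by simp }
  exact hPicard.exists_eq_forall_mem_Icc_hasDerivWithinAt₀

theorem ballCutoff_smul (hf : LipschitzOnBounded f) (hf0 : IsEquilibriumZero f) (R : ℝ) :
    LipschitzOnBounded fun z t => ballCutoff R z • f z t := by
  intro ρ
  obtain ⟨K, hK⟩ := hf ρ
  obtain ⟨C, hC⟩ := hf.exists_norm_le hf0 ρ
  refine ⟨K + C, fun t ht => LipschitzOnWith.of_dist_le_mul fun z hz w hw => ?_⟩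
  rw [dist_eq_norm, dist_eq_norm]
  have hcutoff : ‖ballCutoff R z - ballCutoff R w‖ ≤ ‖z - w‖ := by
    simpa using (lipschitzWith_ballCutoff R).norm_sub_le z w
  calc ‖ballCutoff R z • f z t - ballCutoff R w • f w t‖
      = ‖ballCutoff R z • (f z t - f w t) + (ballCutoff R z - ballCutoff R w) • f w t‖ := by
        congr 1; module
    _ ≤ ‖f z t - f w t‖ + ‖ballCutoff R z - ballCutoff R w‖ * ‖f w t‖ := by
        rw [← norm_smul]
        exact (norm_add_le _ _).trans (by gcongr; exact norm_ballCutoff_smul_le R z _)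
    _ ≤ K * ‖z - w‖ + ‖z - w‖ * C := by
        gcongr
        · exact (hK t ht).norm_sub_le hz hw
        · exact hC t ht w (by simpa using hw)
    _ = (K + C : ℝ≥0) * ‖z - w‖ := by push_cast; ring

theorem exists_isSolutionFrom_ballCutoff_smul [CompleteSpace E] (hf : LipschitzOnBounded f)
    (hf0 : IsEquilibriumZero f) (hcont : ∀ z, ContinuousOn (f z) (Ici 0)) (R : ℝ) (ht₀ : 0 ≤ t₀)
    (x₀ : E) : ∃ s, IsSolutionFrom (fun z t => ballCutoff R z • f z t) t₀ x₀ s := by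
  obtain ⟨C, hC⟩ := hf.exists_norm_le hf0 (R + 1)
  refine (hf.ballCutoff_smul hf0 R).exists_isSolutionFrom_of_norm_le
    (fun z => (hcont z).const_smul _) (C := C) (fun t ht z => ?_) ht₀ x₀
  rcases le_total ‖z‖ (R + 1) with hz | hz
  · exact (norm_ballCutoff_smul_le R z _).trans (hC t ht z hz)
  · simp [ballCutoff_eq_zero hz]

end LipschitzOnBounded

end Solutions

/-- `V` is a Lyapunov function for `x' = f(x, t)`, `t ≥ 0`, pinched between `l ‖z‖²` and
`m ‖z‖²`. -/
structure IsLyapunovFunction {E : Type*} [NormedAddCommGroup E] [NormedSpace ℝ E]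
    (f : E → ℝ → E) (V : E → ℝ) (l m : ℝ) : Prop where
  differentiable : Differentiable ℝ V
  fderiv_nonpos : ∀ t, 0 ≤ t → ∀ z, fderiv ℝ V z (f z t) ≤ 0
  pos : 0 < l
  mul_norm_sq_le : ∀ z, l * ‖z‖ ^ 2 ≤ V z
  le_mul_norm_sq : ∀ z, V z ≤ m * ‖z‖ ^ 2

section Lyapunov

variable {E F : Type*} [NormedAddCommGroup E] [NormedSpace ℝ E] [NormedAddCommGroup F]
  [NormedSpace ℝ F] {f : E → ℝ → E} {V : E → ℝ} {l m : ℝ}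

/-- A strong form of detectability of `x' = f(x, t)` through the output `h x`, uniform in the
initial time: a solution that stays in a given ball and whose output is small over one window of
length `L` starts close to `0`. -/
def UniformlyDetectable (f : E → ℝ → E) (h : E →L[ℝ] F) : Prop :=
  ∀ R : ℝ, ∀ η > 0, ∃ ε > 0, ∃ L ≥ 0, ∀ t₀, 0 ≤ t₀ → ∀ (x₀ : E) (s : ℝ → E),
    IsSolutionFrom f t₀ x₀ s → (∀ t ∈ Ici t₀, ‖s t‖ ≤ R) →
      (∀ t ∈ Icc t₀ (t₀ + L), ‖h (s t)‖ ≤ ε) → ‖x₀‖ ≤ η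

namespace IsSolutionFrom

variable {t₀ t : ℝ} {x₀ : E} {s : ℝ → E}

theorem continuousOn_comp (hs : IsSolutionFrom f t₀ x₀ s) (hV : Differentiable ℝ V) :
    ContinuousOn (fun t => V (s t)) (Ici t₀) :=
  hV.continuous.comp_continuousOn hs.continuousOn

theorem hasDerivWithinAt_comp (hs : IsSolutionFrom f t₀ x₀ s) (hV : Differentiable ℝ V)
    (ht : t₀ ≤ t) :
    HasDerivWithinAt (fun t => V (s t)) (fderiv ℝ V (s t) (f (s t) t)) (Ici t) t :=
  (hV (s t)).hasFDerivAt.comp_hasDerivWithinAt t ((hs.restart ht).2 t self_mem_Ici)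

end IsSolutionFrom

namespace IsLyapunovFunction

variable {t₀ t : ℝ} {x₀ : E} {s : ℝ → E}

theorem apply_le (hV : IsLyapunovFunction f V l m) (ht₀ : 0 ≤ t₀) (hs : IsSolutionFrom f t₀ x₀ s)
    (ht : t₀ ≤ t) : V (s t) ≤ V x₀ := by
  have := image_le_sub_mul_of_deriv_right_le (c := 0) ht
    ((hs.continuousOn_comp hV.differentiable).mono Icc_subset_Ici_self)
    (fun τ hτ => hs.hasDerivWithinAt_comp hV.differentiable hτ.1)
    (fun τ hτ => by simpa using hV.fderiv_nonpos τ (ht₀.trans hτ.1) (s τ))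
  simpa [hs.1] using this

theorem norm_le (hV : IsLyapunovFunction f V l m) (ht₀ : 0 ≤ t₀)
    (hs : IsSolutionFrom f t₀ x₀ s) (ht : t₀ ≤ t) : ‖s t‖ ≤ √(m / l) * ‖x₀‖ := by
  have hsq : ‖s t‖ ^ 2 ≤ m / l * ‖x₀‖ ^ 2 := by
    rw [div_mul_eq_mul_div, le_div_iff₀' hV.pos]
    exact (hV.mul_norm_sq_le _).trans ((hV.apply_le ht₀ hs ht).trans (hV.le_mul_norm_sq _))
  calc ‖s t‖ ≤ √(m / l * ‖x₀‖ ^ 2) := Real.le_sqrt_of_sq_le hsq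
    _ = √(m / l) * ‖x₀‖ := by rw [Real.sqrt_mul' _ (sq_nonneg _), Real.sqrt_sq (norm_nonneg _)]

theorem norm_le_of_norm_le (hV : IsLyapunovFunction f V l m) (ht₀ : 0 ≤ t₀)
    (hs : IsSolutionFrom f t₀ x₀ s) {ε : ℝ} (hx₀ : ‖x₀‖ ≤ ε / (√(m / l) + 1))
    (ht : t₀ ≤ t) : ‖s t‖ ≤ ε := by
  rw [le_div_iff₀' (by positivity)] at hx₀
  linarith [hV.norm_le ht₀ hs ht, norm_nonneg x₀]

theorem uniformlyStable (hV : IsLyapunovFunction f V l m) : UniformlyStable f := fun ε hε =>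
  ⟨ε / (√(m / l) + 1), by positivity,
    fun _ ht₀ _ _ hs hx₀ _ ht => hV.norm_le_of_norm_le ht₀ hs hx₀ ht⟩

theorem uniformlyBounded (hV : IsLyapunovFunction f V l m) : UniformlyBounded f := fun ρ _ =>
  ⟨√(m / l) * ρ, fun _ ht₀ _ _ hs hx₀ _ ht => (hV.norm_le ht₀ hs ht).trans (by gcongr)⟩

theorem ballCutoff_smul (hV : IsLyapunovFunction f V l m) (R : ℝ) :
    IsLyapunovFunction (fun z t => ballCutoff R z • f z t) V l m :=
  { hV with
    fderiv_nonpos := fun t ht z => by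
      rw [map_smul]
      exact mul_nonpos_of_nonneg_of_nonpos (ballCutoff_nonneg R z) (hV.fderiv_nonpos t ht z) }

theorem hasTransitionFunction [CompleteSpace E] (hV : IsLyapunovFunction f V l m)
    (hf : LipschitzOnBounded f) (hf0 : IsEquilibriumZero f)
    (hcont : ∀ z, ContinuousOn (f z) (Ici 0)) : HasTransitionFunction f := by
  intro t₀ ht₀ x₀
  obtain ⟨s, hs⟩ :=
    hf.exists_isSolutionFrom_ballCutoff_smul hf0 hcont (√(m / l) * ‖x₀‖) ht₀ x₀
  have hsf : IsSolutionFrom f t₀ x₀ s := ⟨hs.1, fun t ht => by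
    simpa only [ballCutoff_eq_one ((hV.ballCutoff_smul _).norm_le ht₀ hs ht), one_smul]
      using hs.2 t ht⟩
  exact ⟨s, hsf, fun s' hs' => hf.eqOn_Ici ht₀ hs' hsf⟩

theorem isDissipatedBy (hV : IsLyapunovFunction f V l m) {h : E →L[ℝ] F} {q : ℝ}
    (hdiss : ∀ t, 0 ≤ t → ∀ z, fderiv ℝ V z (f z t) ≤ -(q * ‖h z‖ ^ 2)) (ht₀ : 0 ≤ t₀)
    (hs : IsSolutionFrom f t₀ x₀ s) {C : ℝ≥0} (hC : ∀ t ∈ Ici t₀, ‖f (s t) t‖ ≤ C) :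
    IsDissipatedBy q (‖h‖₊ * C) t₀ (fun t => V (s t)) (fun t => h (s t)) where
  nonneg t _ := (mul_nonneg hV.pos.le (sq_nonneg _)).trans (hV.mul_norm_sq_le (s t))
  continuousOn := hs.continuousOn_comp hV.differentiable
  exists_deriv_le t ht :=
    ⟨_, hs.hasDerivWithinAt_comp hV.differentiable ht, hdiss t (ht₀.trans ht) (s t)⟩
  lipschitzOnWith := h.lipschitz.comp_lipschitzOnWith (hs.lipschitzOnWith hC)

/- The storage `V` can pay for only finitely many windows with a large output, so some window has a
small output; detectability makes the state small at its start, and stability keeps it small. -/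
theorem uniformlyAttractingInTheLarge (hV : IsLyapunovFunction f V l m)
    (hf : LipschitzOnBounded f) (hf0 : IsEquilibriumZero f) {h : E →L[ℝ] F} {q : ℝ} (hq : 0 < q)
    (hdiss : ∀ t, 0 ≤ t → ∀ z, fderiv ℝ V z (f z t) ≤ -(q * ‖h z‖ ^ 2))
    (hdet : UniformlyDetectable f h) : UniformlyAttractingInTheLarge f := by
  intro ρ _ η hη
  set R := √(m / l) * ρ
  obtain ⟨C, hC⟩ := hf.exists_norm_le hf0 R
  obtain ⟨ε, hε, L, hL, hsmall⟩ := hdet R (η / (√(m / l) + 1)) (by positivity)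
  obtain ⟨T, hT, hwindow⟩ := IsDissipatedBy.exists_window_forall_norm_lt (E := F) hq hε hL
    (‖h‖₊ * C) (|m| * ρ ^ 2)
  refine ⟨T, hT, fun t₀ ht₀ x₀ s hs hx₀ t ht => ?_⟩
  have hsR : ∀ τ ∈ Ici t₀, ‖s τ‖ ≤ R := fun τ hτ =>
    (hV.norm_le ht₀ hs hτ).trans (mul_le_mul_of_nonneg_left hx₀ (Real.sqrt_nonneg _))
  have hVx₀ : V (s t₀) ≤ |m| * ρ ^ 2 := by
    rw [hs.1]
    exact (hV.le_mul_norm_sq x₀).trans (by gcongr; exact le_abs_self m)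
  obtain ⟨a, ha, hout⟩ := hwindow t₀ _ _
    (hV.isDissipatedBy hdiss ht₀ hs fun τ hτ => hC τ (ht₀.trans hτ) _ (hsR τ hτ)) hVx₀
  have hsa : ‖s a‖ ≤ η / (√(m / l) + 1) := hsmall a (ht₀.trans ha.1) (s a) s (hs.restart ha.1)
    (fun τ hτ => hsR τ (ha.1.trans hτ)) fun τ hτ => (hout τ hτ).le
  exact hV.norm_le_of_norm_le (ht₀.trans ha.1) (hs.restart ha.1) hsa (ha.2.trans ht)

end IsLyapunovFunction

end Lyapunov

section LinearConjugacy

variable {E F : Type*} [NormedAddCommGroup E] [NormedSpace ℝ E] [NormedAddCommGroup F]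
  [NormedSpace ℝ F] {f : E → ℝ → E} {g : F → ℝ → F}

theorem IsSolutionFrom.map {L : E →L[ℝ] F} (hL : ∀ z t, L (f z t) = g (L z) t) {t₀ : ℝ} {x₀ : E}
    {s : ℝ → E} (hs : IsSolutionFrom f t₀ x₀ s) : IsSolutionFrom g t₀ (L x₀) (L ∘ s) :=
  ⟨congrArg L hs.1, fun t ht => by
    simpa only [Function.comp_apply, hL] using
      L.hasFDerivAt.comp_hasDerivWithinAt t (hs.2 t ht)⟩

variable (L : E ≃ₗᵢ[ℝ] F)

theorem isEquilibriumZero_of_conjugate (hL : ∀ z t, L (f z t) = g (L z) t)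
    (hg : IsEquilibriumZero g) : IsEquilibriumZero f :=
  fun t ht => L.injective (by rw [hL, map_zero, hg t ht])

theorem hasTransitionFunction_of_conjugate (hL : ∀ z t, L (f z t) = g (L z) t)
    (hg : HasTransitionFunction g) : HasTransitionFunction f := by
  have hLsymm : ∀ z t, (L.symm : F →L[ℝ] E) (g z t) = f ((L.symm : F →L[ℝ] E) z) t :=
    fun z t => L.injective (by simp [hL])
  intro t₀ ht₀ x₀
  obtain ⟨s, hs, huniq⟩ := hg t₀ ht₀ (L x₀)
  refine ⟨L.symm ∘ s, by simpa using hs.map hLsymm, fun s' hs' t ht => ?_⟩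
  have := huniq _ (hs'.map (L := (L : E →L[ℝ] F)) hL) ht
  exact L.injective (by simpa using this)

theorem isUASL_of_conjugate (hL : ∀ z t, L (f z t) = g (L z) t) (hg : IsUASL g) : IsUASL f := by
  have hmap : ∀ {t₀ x₀ s}, IsSolutionFrom f t₀ x₀ s → IsSolutionFrom g t₀ (L x₀) (L ∘ s) :=
    fun hs => hs.map (L := (L : E →L[ℝ] F)) hL
  obtain ⟨hstable, hbounded, hattracting⟩ := hg
  refine ⟨fun ε hε => ?_, fun ρ hρ => ?_, fun ρ hρ η hη => ?_⟩
  · obtain ⟨δ, hδ, h⟩ := hstable ε hε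
    exact ⟨δ, hδ, fun t₀ ht₀ x₀ s hs hx₀ t ht => by
      simpa using h t₀ ht₀ (L x₀) _ (hmap hs) (by simpa using hx₀) t ht⟩
  · obtain ⟨β, h⟩ := hbounded ρ hρ
    exact ⟨β, fun t₀ ht₀ x₀ s hs hx₀ t ht => by
      simpa using h t₀ ht₀ (L x₀) _ (hmap hs) (by simpa using hx₀) t ht⟩
  · obtain ⟨T, hT, h⟩ := hattracting ρ hρ η hη
    exact ⟨T, hT, fun t₀ ht₀ x₀ s hs hx₀ t ht => by
      simpa using h t₀ ht₀ (L x₀) _ (hmap hs) (by simpa using hx₀) t ht⟩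

end LinearConjugacy

section SignalDrivenField

variable {E F : Type*} [NormedAddCommGroup E] [NormedSpace ℝ E] [ProperSpace E]
  [NormedAddCommGroup F] [NormedSpace ℝ F] [ProperSpace F] {g : E → F → E} {w : ℝ → F}

theorem exists_lipschitzOnWith_closedBall_prod (hg : ContDiff ℝ 1 fun p : E × F => g p.1 p.2)
    (R β : ℝ) :
    ∃ K, LipschitzOnWith K (fun p : E × F => g p.1 p.2)
      (Metric.closedBall 0 R ×ˢ Metric.closedBall 0 β) :=
  hg.contDiffOn.exists_lipschitzOnWith one_ne_zero
    ((convex_closedBall 0 R).prod (convex_closedBall 0 β))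
    ((isCompact_closedBall 0 R).prod (isCompact_closedBall 0 β))

theorem lipschitzOnBounded_of_contDiff (hg : ContDiff ℝ 1 fun p : E × F => g p.1 p.2)
    (hw : BoundedSignal w) : LipschitzOnBounded fun z t => g z (w t) := by
  obtain ⟨β, hβ⟩ := hw
  intro R
  obtain ⟨K, hK⟩ := exists_lipschitzOnWith_closedBall_prod hg R β
  refine ⟨K, fun t ht => ?_⟩
  have hpair : LipschitzOnWith 1 (fun z : E => (z, w t)) (Metric.closedBall 0 R) :=
    (LipschitzWith.prodMk_right (w t)).lipschitzOnWith
  simpa only [mul_one, Function.comp_def] using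
    hK.comp hpair fun z hz => ⟨hz, by simpa using hβ t ht⟩

theorem exists_lipschitzOnWith_comp_of_contDiff (hg : ContDiff ℝ 1 fun p : E × F => g p.1 p.2)
    (hg0 : IsEquilibriumZero fun z t => g z (w t)) {K : ℝ≥0} (hw : LipschitzOnWith K w (Ici 0))
    (hwb : BoundedSignal w) (R : ℝ) :
    ∃ M, ∀ t₀, 0 ≤ t₀ → ∀ x₀ s, IsSolutionFrom (fun z t => g z (w t)) t₀ x₀ s →
      (∀ t ∈ Ici t₀, ‖s t‖ ≤ R) → LipschitzOnWith M (fun t => g (s t) (w t)) (Ici t₀) := by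
  obtain ⟨C, hC⟩ := (lipschitzOnBounded_of_contDiff hg hwb).exists_norm_le hg0 R
  obtain ⟨β, hβ⟩ := hwb
  obtain ⟨N, hN⟩ := exists_lipschitzOnWith_closedBall_prod hg R β
  refine ⟨N * max C K, fun t₀ ht₀ x₀ s hs hR => ?_⟩
  have hsLip := hs.lipschitzOnWith fun t ht => hC t (ht₀.trans ht) _ (hR t ht)
  exact hN.comp (hsLip.prodMk (hw.mono (Ici_subset_Ici.2 ht₀)))
    fun t ht => ⟨by simpa using hR t ht, by simpa using hβ t (ht₀.trans ht)⟩

end SignalDrivenField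

section AdaptiveError

variable {H : Type*} [NormedAddCommGroup H] [InnerProductSpace ℝ H]

/-- The right-hand side of the error dynamics of model reference adaptive control in an inner
product space, at the state `z = (e, φ)` and for the value `v` of the reference state, so that
`v + e` is the plant state. The state space carries the norm `(‖e‖² + ‖φ‖²)^(1/2)`. -/
noncomputable def adaptiveVelocity (A : H →L[ℝ] H) (b c : H) (z : WithLp 2 (H × H)) (v : H) :
    WithLp 2 (H × H) :=
  WithLp.toLp 2 (A z.fst + ⟪v + z.fst, z.snd⟫ • b, -(⟪c, z.fst⟫ • (v + z.fst)))

/-- The time-varying field of the error dynamics when the reference state is the signal `w`. -/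
noncomputable def adaptiveField (A : H →L[ℝ] H) (b c : H) (w : ℝ → H) (z : WithLp 2 (H × H))
    (t : ℝ) : WithLp 2 (H × H) :=
  adaptiveVelocity A b c z (w t)

variable {A : H →L[ℝ] H} {b c : H} {w : ℝ → H}

theorem isEquilibriumZero_adaptiveField : IsEquilibriumZero (adaptiveField A b c w) :=
  fun _ _ => by simp [adaptiveField, adaptiveVelocity]

theorem contDiff_adaptiveVelocity (A : H →L[ℝ] H) (b c : H) :
    ContDiff ℝ 1 fun p : WithLp 2 (H × H) × H => adaptiveVelocity A b c p.1 p.2 := by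
  have he : ContDiff ℝ 1 fun p : WithLp 2 (H × H) × H => p.1.fst :=
    (WithLp.fstL 2 ℝ H H).contDiff.comp contDiff_fst
  have hφ : ContDiff ℝ 1 fun p : WithLp 2 (H × H) × H => p.1.snd :=
    (WithLp.sndL 2 ℝ H H).contDiff.comp contDiff_fst
  have hx := contDiff_snd.add he
  exact (WithLp.prodContinuousLinearEquiv 2 ℝ H H).symm.contDiff.comp
    (((A.contDiff.comp he).add ((hx.inner ℝ hφ).smul contDiff_const)).prodMk
      (((contDiff_const.inner ℝ he).smul hx).neg))

end AdaptiveError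

/-- `P` is symmetric positive definite and satisfies the Lyapunov inequality `AᵀP + PA ≺ 0`. -/
structure IsLyapunovOperator {H : Type*} [NormedAddCommGroup H] [InnerProductSpace ℝ H]
    (A P : H →L[ℝ] H) : Prop where
  isSymmetric : (P : H →ₗ[ℝ] H).IsSymmetric
  pos : ∀ v, v ≠ 0 → 0 < ⟪v, P v⟫
  neg : ∀ v, v ≠ 0 → ⟪P v, A v⟫ < 0

section Coercivity

variable {H : Type*} [NormedAddCommGroup H] [InnerProductSpace ℝ H] [FiniteDimensional ℝ H]

theorem exists_mul_norm_sq_le_inner (M : H →L[ℝ] H) (hM : ∀ v, v ≠ 0 → 0 < ⟪v, M v⟫) :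
    ∃ q > 0, ∀ v, q * ‖v‖ ^ 2 ≤ ⟪v, M v⟫ := by
  rcases subsingleton_or_nontrivial H with _ | _
  · exact ⟨1, one_pos, fun v => by simp [Subsingleton.elim v 0]⟩
  have : ProperSpace H := FiniteDimensional.proper ℝ H
  obtain ⟨u, hu, hmin⟩ := (isCompact_sphere (0 : H) 1).exists_isMinOn
    (NormedSpace.sphere_nonempty.2 zero_le_one) (f := fun v => ⟪v, M v⟫) (by fun_prop)
  refine ⟨_, hM u (ne_zero_of_mem_unit_sphere ⟨u, hu⟩), fun v => ?_⟩
  rcases eq_or_ne v 0 with rfl | hv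
  · simp
  have hunit : ⟪u, M u⟫ ≤ ⟪‖v‖⁻¹ • v, M (‖v‖⁻¹ • v)⟫ :=
    hmin (by simp [norm_smul, hv] : ‖v‖⁻¹ • v ∈ Metric.sphere (0 : H) 1)
  have hv' : ‖v‖ ≠ 0 := norm_ne_zero_iff.2 hv
  calc ⟪u, M u⟫ * ‖v‖ ^ 2 ≤ ⟪‖v‖⁻¹ • v, M (‖v‖⁻¹ • v)⟫ * ‖v‖ ^ 2 := by gcongr
    _ = ⟪v, M v⟫ := by
      rw [map_smul, real_inner_smul_left, real_inner_smul_right]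
      field_simp

namespace IsLyapunovOperator

variable {A P : H →L[ℝ] H}

theorem exists_mul_norm_sq_le (hP : IsLyapunovOperator A P) :
    ∃ p > 0, ∀ v, p * ‖v‖ ^ 2 ≤ ⟪v, P v⟫ :=
  exists_mul_norm_sq_le_inner P hP.pos

theorem exists_two_mul_inner_le (hP : IsLyapunovOperator A P) :
    ∃ q > 0, ∀ v, 2 * ⟪P v, A v⟫ ≤ -(q * ‖v‖ ^ 2) := by
  have hform : ∀ v, ⟪v, (-(P ∘L A)) v⟫ = -⟪P v, A v⟫ := fun v => by
    rw [show ⟪P v, A v⟫ = ⟪v, P (A v)⟫ from hP.isSymmetric v (A v), ← inner_neg_right]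
    rfl
  obtain ⟨q, hq, hle⟩ := exists_mul_norm_sq_le_inner (-(P ∘L A)) fun v hv => by
    simpa only [hform, Left.neg_pos_iff] using hP.neg v hv
  exact ⟨2 * q, by positivity, fun v => by linarith [hle v, hform v]⟩

end IsLyapunovOperator

end Coercivity

section Energy

variable {H : Type*} [NormedAddCommGroup H] [InnerProductSpace ℝ H] {A P : H →L[ℝ] H} {b : H}
  {w : ℝ → H}

/-- The quadratic energy `⟪e, P e⟫ + ‖φ‖²` of the state `z = (e, φ)`. -/
noncomputable def adaptiveEnergy (P : H →L[ℝ] H) (z : WithLp 2 (H × H)) : ℝ :=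
  ⟪z.fst, P z.fst⟫ + ‖z.snd‖ ^ 2

theorem differentiable_adaptiveEnergy (P : H →L[ℝ] H) : Differentiable ℝ (adaptiveEnergy P) := by
  have he : Differentiable ℝ fun z : WithLp 2 (H × H) => z.fst :=
    (WithLp.fstL 2 ℝ H H).differentiable
  exact (he.inner ℝ (P.differentiable.comp he)).add
    ((WithLp.sndL 2 ℝ H H).differentiable.norm_sq ℝ)

theorem fderiv_adaptiveEnergy (hP : (P : H →ₗ[ℝ] H).IsSymmetric) (z v : WithLp 2 (H × H)) :
    fderiv ℝ (adaptiveEnergy P) z v = 2 * ⟪P z.fst, v.fst⟫ + 2 * ⟪z.snd, v.snd⟫ := by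
  have he : HasFDerivAt (fun z : WithLp 2 (H × H) => z.fst) (WithLp.fstL 2 ℝ H H) z :=
    (WithLp.fstL 2 ℝ H H).hasFDerivAt
  have hφ : HasFDerivAt (fun z : WithLp 2 (H × H) => z.snd) (WithLp.sndL 2 ℝ H H) z :=
    (WithLp.sndL 2 ℝ H H).hasFDerivAt
  have hsymm : ⟪z.fst, P v.fst⟫ = ⟪P z.fst, v.fst⟫ := (hP z.fst v.fst).symm
  have hV : HasFDerivAt (adaptiveEnergy P) _ z :=
    (he.inner ℝ (P.hasFDerivAt.comp z he)).add hφ.norm_sq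
  rw [hV.fderiv]
  simp only [Function.comp_apply, add_apply, ContinuousLinearMap.comp_apply,
    ContinuousLinearMap.prod_apply, WithLp.fstL_apply, fderivInnerCLM_apply, hsymm,
    real_inner_comm (P z.fst), smul_apply, WithLp.sndL_apply, coe_innerSL_apply, nsmul_eq_mul,
    Nat.cast_ofNat]
  ring

/- With the output vector `P b`, the terms of the two equations that contain the plant state
cancel. -/
theorem fderiv_adaptiveEnergy_adaptiveField (hP : (P : H →ₗ[ℝ] H).IsSymmetric)
    (z : WithLp 2 (H × H)) (t : ℝ) :
    fderiv ℝ (adaptiveEnergy P) z (adaptiveField A b (P b) w z t) =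
      2 * ⟪P z.fst, A z.fst⟫ := by
  have hsymm : ⟪P z.fst, b⟫ = ⟪P b, z.fst⟫ := (hP z.fst b).trans (real_inner_comm _ _)
  rw [fderiv_adaptiveEnergy hP]
  simp only [adaptiveField, adaptiveVelocity, WithLp.toLp_fst, WithLp.toLp_snd, inner_add_right,
    inner_neg_right, real_inner_smul_right, hsymm, real_inner_comm z.snd]
  ring

theorem exists_isLyapunovFunction_adaptiveEnergy [FiniteDimensional ℝ H]
    (hP : IsLyapunovOperator A P) :
    ∃ l m, IsLyapunovFunction (adaptiveField A b (P b) w) (adaptiveEnergy P) l m := by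
  obtain ⟨p, hp, hpP⟩ := hP.exists_mul_norm_sq_le
  obtain ⟨q, hq, hqA⟩ := hP.exists_two_mul_inner_le
  refine ⟨min p 1, ‖P‖ + 1,
    { differentiable := differentiable_adaptiveEnergy P
      fderiv_nonpos := fun t _ z => ?_
      pos := lt_min hp one_pos
      mul_norm_sq_le := fun z => ?_
      le_mul_norm_sq := fun z => ?_ }⟩
  · rw [fderiv_adaptiveEnergy_adaptiveField hP.isSymmetric]
    exact (hqA z.fst).trans (neg_nonpos.2 (by positivity))
  · calc min p 1 * ‖z‖ ^ 2 = min p 1 * ‖z.fst‖ ^ 2 + min p 1 * ‖z.snd‖ ^ 2 := by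
          rw [WithLp.prod_norm_sq_eq_of_L2, mul_add]
      _ ≤ p * ‖z.fst‖ ^ 2 + 1 * ‖z.snd‖ ^ 2 := by
          gcongr
          exacts [min_le_left p 1, min_le_right p 1]
      _ ≤ adaptiveEnergy P z := by
          rw [one_mul]
          exact add_le_add_left (hpP z.fst) _
  · have hPz : ⟪z.fst, P z.fst⟫ ≤ ‖P‖ * ‖z.fst‖ ^ 2 :=
      calc ⟪z.fst, P z.fst⟫ ≤ ‖z.fst‖ * ‖P z.fst‖ := real_inner_le_norm _ _
        _ ≤ ‖z.fst‖ * (‖P‖ * ‖z.fst‖) := by gcongr; exact P.le_opNorm _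
        _ = ‖P‖ * ‖z.fst‖ ^ 2 := by ring
    rw [adaptiveEnergy, WithLp.prod_norm_sq_eq_of_L2]
    nlinarith [norm_nonneg P, sq_nonneg ‖z.fst‖, sq_nonneg ‖z.snd‖]

end Energy

section Excitation

variable {H : Type*} [NormedAddCommGroup H] [InnerProductSpace ℝ H]

/-- Persistent excitation of `w` with window `T` and level `α`: the condition
`∫ₜ^{t+T} w wᵀ ⪰ α I` for all `t ≥ 0`, expressed by quadratic forms. -/
def IsExciting (T α : ℝ) (w : ℝ → H) : Prop :=
  ∀ t, 0 ≤ t → ∀ v, α * ‖v‖ ^ 2 ≤ ∫ τ in t..(t + T), ⟪w τ, v⟫ ^ 2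

theorem IsExciting.mul_norm_sq_le {T α δ t : ℝ} {w : ℝ → H} {v : H} (hw : IsExciting T α w)
    (hT : 0 ≤ T) (ht : 0 ≤ t) (hδ : ∀ τ ∈ Icc t (t + T), |⟪w τ, v⟫| ≤ δ) :
    α * ‖v‖ ^ 2 ≤ δ ^ 2 * T := by
  have hint : ‖∫ τ in t..(t + T), ⟪w τ, v⟫ ^ 2‖ ≤ δ ^ 2 * |t + T - t| :=
    intervalIntegral.norm_integral_le_of_norm_le_const fun τ hτ => by
      rw [uIoc_of_le (by linarith)] at hτ
      rw [norm_pow, Real.norm_eq_abs]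
      have := hδ τ (Ioc_subset_Icc_self hτ)
      gcongr
  rw [add_sub_cancel_left, abs_of_nonneg hT] at hint
  exact (hw t ht v).trans ((Real.le_norm_self _).trans hint)

end Excitation

section Detectability

variable {H : Type*} [NormedAddCommGroup H] [InnerProductSpace ℝ H] {A : H →L[ℝ] H} {b c : H}
  {w : ℝ → H} {t₀ t : ℝ} {x₀ : WithLp 2 (H × H)} {s : ℝ → WithLp 2 (H × H)}

theorem hasDerivWithinAt_fst (hs : IsSolutionFrom (adaptiveField A b c w) t₀ x₀ s) (ht : t₀ ≤ t) :
    HasDerivWithinAt (fun t => (s t).fst) (adaptiveField A b c w (s t) t).fst (Ici t₀) t :=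
  (WithLp.fstL 2 ℝ H H).hasFDerivAt.comp_hasDerivWithinAt t (hs.2 t ht)

theorem hasDerivWithinAt_snd (hs : IsSolutionFrom (adaptiveField A b c w) t₀ x₀ s) (ht : t₀ ≤ t) :
    HasDerivWithinAt (fun t => (s t).snd) (adaptiveField A b c w (s t) t).snd (Ici t₀) t :=
  (WithLp.sndL 2 ℝ H H).hasFDerivAt.comp_hasDerivWithinAt t (hs.2 t ht)

theorem norm_snd_sub_le_of_norm_fst_le (hs : IsSolutionFrom (adaptiveField A b c w) t₀ x₀ s)
    {β ε : ℝ} (hβ : ∀ τ ∈ Icc t₀ t, ‖w τ‖ ≤ β) (hε : ∀ τ ∈ Icc t₀ t, ‖(s τ).fst‖ ≤ ε)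
    (ht : t₀ ≤ t) :
    ‖(s t).snd - x₀.snd‖ ≤ ‖c‖ * ε * (β + ε) * (t - t₀) := by
  rw [← hs.1]
  refine norm_image_sub_le_of_norm_deriv_le_segment' (f := fun t => (s t).snd)
    (fun τ hτ => (hasDerivWithinAt_snd hs hτ.1).mono Icc_subset_Ici_self)
    (fun τ hτ => ?_) t (right_mem_Icc.2 ht)
  have heτ := hε τ (Ico_subset_Icc_self hτ)
  have hwτ := hβ τ (Ico_subset_Icc_self hτ)
  have hε0 : 0 ≤ ε := (norm_nonneg _).trans heτ
  calc ‖(adaptiveField A b c w (s τ) τ).snd‖ = |⟪c, (s τ).fst⟫| * ‖w τ + (s τ).fst‖ := by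
        rw [← Real.norm_eq_abs, ← norm_smul]
        exact norm_neg _
    _ ≤ (‖c‖ * ‖(s τ).fst‖) * (‖w τ‖ + ‖(s τ).fst‖) :=
        mul_le_mul (abs_real_inner_le_norm _ _) (norm_add_le _ _) (norm_nonneg _) (by positivity)
    _ ≤ ‖c‖ * ε * (β + ε) := by gcongr

theorem abs_inner_add_mul_norm_le_of_norm_fst_le
    (hs : IsSolutionFrom (adaptiveField A b c w) t₀ x₀ s) {M : ℝ≥0}
    (hM : LipschitzOnWith M (fun t => adaptiveField A b c w (s t) t) (Ici t₀)) {ε h : ℝ}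
    (hh : 0 < h) (ht : t₀ ≤ t) (hε : ∀ τ ∈ Icc t (t + h), ‖(s τ).fst‖ ≤ ε) :
    |⟪w t + (s t).fst, (s t).snd⟫| * ‖b‖ ≤ 2 * ε / h + M * h + ‖A‖ * ε := by
  have hsub : Icc t (t + h) ⊆ Ici t₀ := fun τ hτ => ht.trans hτ.1
  have hfst : LipschitzOnWith M (fun t => (adaptiveField A b c w (s t) t).fst) (Icc t (t + h)) :=
    LipschitzOnWith.of_dist_le_mul fun τ hτ σ hσ => by
      refine le_trans ?_ (hM.dist_le_mul τ (hsub hτ) σ (hsub hσ))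
      rw [dist_eq_norm, dist_eq_norm, ← WithLp.sub_fst]
      exact WithLp.norm_fst_le _ _
  have hvelocity : ‖(adaptiveField A b c w (s t) t).fst‖ ≤ 2 * ε / h + M * h :=
    norm_deriv_le_of_norm_le_of_lipschitzOnWith hh
      (fun τ hτ => (hasDerivWithinAt_fst hs (hsub hτ)).mono hsub) hfst hε
  have het : ‖(s t).fst‖ ≤ ε := hε t (left_mem_Icc.2 (by linarith))
  calc |⟪w t + (s t).fst, (s t).snd⟫| * ‖b‖
      = ‖(adaptiveField A b c w (s t) t).fst - A (s t).fst‖ := by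
        rw [← Real.norm_eq_abs, ← norm_smul]
        exact congrArg norm (add_sub_cancel_left _ _).symm
    _ ≤ ‖(adaptiveField A b c w (s t) t).fst‖ + ‖A (s t).fst‖ := norm_sub_le _ _
    _ ≤ 2 * ε / h + M * h + ‖A‖ * ε := add_le_add hvelocity (A.le_opNorm_of_le het)

theorem abs_inner_le_of_norm_fst_le (hs : IsSolutionFrom (adaptiveField A b c w) t₀ x₀ s) {M : ℝ≥0}
    (hM : LipschitzOnWith M (fun t => adaptiveField A b c w (s t) t) (Ici t₀)) (hb : b ≠ 0)
    {R β ε T : ℝ} (hR : ‖(s t).snd‖ ≤ R) (hβ : ∀ τ ∈ Icc t₀ t, ‖w τ‖ ≤ β) (hε0 : 0 < ε)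
    (hε1 : ε ≤ 1) (hε : ∀ τ ∈ Icc t₀ (t₀ + (T + 1)), ‖(s τ).fst‖ ≤ ε) (ht : t ∈ Icc t₀ (t₀ + T)) :
    |⟪w t, x₀.snd⟫| ≤ ((2 + M) * √ε + ‖A‖ * ε) / ‖b‖ + ε * R + β * (‖c‖ * ε * (β + ε) * T) := by
  have hroot : √ε ≤ 1 := Real.sqrt_le_one.2 hε1
  have hεt : ‖(s t).fst‖ ≤ ε := hε t ⟨ht.1, by linarith [ht.2]⟩
  have hdrift := norm_snd_sub_le_of_norm_fst_le hs hβ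
    (fun τ hτ => hε τ ⟨hτ.1, by linarith [hτ.2, ht.2]⟩) ht.1
  have hwt := hβ t (right_mem_Icc.2 ht.1)
  have hplant : |⟪w t + (s t).fst, (s t).snd⟫| ≤ ((2 + M) * √ε + ‖A‖ * ε) / ‖b‖ := by
    rw [le_div_iff₀ (norm_pos_iff.2 hb)]
    have := abs_inner_add_mul_norm_le_of_norm_fst_le hs hM (Real.sqrt_pos.2 hε0) ht.1
      fun τ hτ => hε τ ⟨ht.1.trans hτ.1, by linarith [hτ.2, ht.2]⟩
    rwa [mul_div_assoc, Real.div_sqrt, ← add_mul] at this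
  have herror : |⟪(s t).fst, (s t).snd⟫| ≤ ε * R :=
    (abs_real_inner_le_norm _ _).trans (by gcongr)
  have hparam : |⟪w t, (s t).snd - x₀.snd⟫| ≤ β * (‖c‖ * ε * (β + ε) * T) := by
    have hβ0 : 0 ≤ β := (norm_nonneg _).trans hwt
    refine (abs_real_inner_le_norm _ _).trans (mul_le_mul hwt (hdrift.trans ?_) (norm_nonneg _) hβ0)
    gcongr
    linarith [ht.2]
  calc |⟪w t, x₀.snd⟫| = |⟪w t + (s t).fst, (s t).snd⟫ - ⟪(s t).fst, (s t).snd⟫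
        - ⟪w t, (s t).snd - x₀.snd⟫| := by
        rw [inner_add_left, inner_sub_right]
        congr 1
        ring
    _ ≤ |⟪w t + (s t).fst, (s t).snd⟫| + |⟪(s t).fst, (s t).snd⟫|
        + |⟪w t, (s t).snd - x₀.snd⟫| := (abs_sub _ _).trans (by gcongr; exact abs_sub _ _)
    _ ≤ _ := by gcongr

theorem exists_pos_le_and_apply_le_of_continuousAt {g : ℝ → ℝ} (hg : ContinuousAt g 0) {δ ε₁ : ℝ}
    (h0 : g 0 < δ) (hε₁ : 0 < ε₁) : ∃ ε, 0 < ε ∧ ε ≤ ε₁ ∧ g ε ≤ δ := by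
  have hg' : ∀ᶠ ε in 𝓝[>] (0 : ℝ), g ε < δ :=
    nhdsWithin_le_nhds (hg.eventually (gt_mem_nhds h0))
  obtain ⟨ε, hgε, hε⟩ := (hg'.and (Ioc_mem_nhdsGT hε₁)).exists
  exact ⟨ε, hε.1, hε.2, hgε.le⟩

theorem uniformlyDetectable_adaptiveField [FiniteDimensional ℝ H] {K : ℝ≥0} {T α : ℝ}
    (hw : LipschitzOnWith K w (Ici 0)) (hwb : BoundedSignal w) (hb : b ≠ 0) (hT : 0 < T)
    (hα : 0 < α) (hexc : IsExciting T α w) :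
    UniformlyDetectable (adaptiveField A b c w) (WithLp.fstL 2 ℝ H H) := by
  intro R η hη
  have : ProperSpace (WithLp 2 (H × H)) := FiniteDimensional.proper ℝ _
  have : ProperSpace H := FiniteDimensional.proper ℝ H
  obtain ⟨M, hM⟩ := exists_lipschitzOnWith_comp_of_contDiff (contDiff_adaptiveVelocity A b c)
    isEquilibriumZero_adaptiveField hw hwb R
  obtain ⟨β, hβ⟩ := hwb
  let g : ℝ → ℝ := fun ε =>
    ((2 + M) * √ε + ‖A‖ * ε) / ‖b‖ + ε * R + β * (‖c‖ * ε * (β + ε) * T)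
  have hδ : g 0 < η / 2 * √(α / T) := by
    simp only [g, Real.sqrt_zero, mul_zero, zero_mul, add_zero, zero_div]
    positivity
  obtain ⟨ε, hε0, hε1, hgε⟩ := exists_pos_le_and_apply_le_of_continuousAt
    (Continuous.continuousAt (by fun_prop : Continuous g)) hδ
    (show 0 < min 1 (η / 2) by positivity)
  refine ⟨ε, hε0, T + 1, by positivity, fun t₀ ht₀ x₀ s hs hR hε => ?_⟩
  have hfst : ‖x₀.fst‖ ≤ η / 2 := by
    rw [← hs.1]
    exact (hε t₀ (left_mem_Icc.2 (by linarith))).trans (hε1.trans (min_le_right _ _))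
  have hsnd : ‖x₀.snd‖ ≤ η / 2 := by
    have hproj : ∀ τ ∈ Icc t₀ (t₀ + T), |⟪w τ, x₀.snd⟫| ≤ η / 2 * √(α / T) := fun τ hτ =>
      (abs_inner_le_of_norm_fst_le hs (hM t₀ ht₀ x₀ s hs hR) hb
        ((WithLp.norm_snd_le _ _).trans (hR τ hτ.1))
        (fun σ hσ => hβ σ (ht₀.trans hσ.1)) hε0 (hε1.trans (min_le_left _ _)) hε hτ).trans hgε
    have hsq := hexc.mul_norm_sq_le hT.le ht₀ hproj
    rw [mul_pow, Real.sq_sqrt (by positivity), mul_assoc, div_mul_cancel₀ _ hT.ne', mul_comm] at hsq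
    exact (sq_le_sq₀ (norm_nonneg _) (by positivity)).1 (le_of_mul_le_mul_right hsq hα)
  refine (sq_le_sq₀ (norm_nonneg _) hη.le).1 ?_
  rw [WithLp.prod_norm_sq_eq_of_L2]
  nlinarith [norm_nonneg x₀.fst, norm_nonneg x₀.snd]

end Detectability

section ReferenceSignal

variable {E : Type*} [NormedAddCommGroup E] [NormedSpace ℝ E]

theorem lipschitzOnWith_Ici_of_norm_deriv_right_le {y y' : ℝ → E} {a : ℝ} {K : ℝ≥0}
    (hy : ContinuousOn y (Ici a)) (hy' : ∀ t ∈ Ici a, HasDerivWithinAt y (y' t) (Ici t) t)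
    (hK : ∀ t ∈ Ici a, ‖y' t‖ ≤ K) : LipschitzOnWith K y (Ici a) := by
  refine LipschitzOnWith.of_dist_le_mul fun t ht t' ht' => ?_
  wlog htt' : t' ≤ t generalizing t t'
  · rw [dist_comm, dist_comm t]
    exact this t' ht' t ht (le_of_not_ge htt')
  rw [dist_eq_norm, Real.dist_eq, abs_of_nonneg (sub_nonneg.2 htt')]
  have hsub : Icc t' t ⊆ Ici a := fun τ hτ => ht'.trans hτ.1
  exact norm_image_sub_le_of_norm_deriv_right_le_segment (hy.mono hsub)
    (fun τ hτ => hy' τ (hsub (Ico_subset_Icc_self hτ)))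
    (fun τ hτ => hK τ (hsub (Ico_subset_Icc_self hτ))) t (right_mem_Icc.2 htt')

theorem exists_lipschitzOnWith_of_linear_deriv_right {A : E →L[ℝ] E} {b : E} {w : ℝ → E}
    {ρ : ℝ → ℝ} (hw : ContinuousOn w (Ici 0))
    (hw' : ∀ t, 0 ≤ t → HasDerivWithinAt w (A (w t) + ρ t • b) (Ici t) t)
    (hwb : BoundedSignal w) (hρ : BoundedSignal ρ) : ∃ K, LipschitzOnWith K w (Ici 0) := by
  obtain ⟨β, hβ⟩ := hwb
  obtain ⟨γ, hγ⟩ := hρ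
  refine ⟨(‖A‖ * β + γ * ‖b‖).toNNReal,
    lipschitzOnWith_Ici_of_norm_deriv_right_le hw hw' fun t ht => ?_⟩
  refine le_trans (norm_add_le_of_le (A.le_opNorm_of_le (hβ t ht)) ?_) (Real.le_coe_toNNReal _)
  rw [norm_smul]
  exact mul_le_mul_of_nonneg_right (hγ t ht) (norm_nonneg b)

variable {H : Type*} [NormedAddCommGroup H] [InnerProductSpace ℝ H] [FiniteDimensional ℝ H]
  {A P : H →L[ℝ] H} {b : H} {w : ℝ → H} {K : ℝ≥0}

theorem IsLyapunovOperator.exists_isDissipatedBy (hP : IsLyapunovOperator A P)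
    (hw : LipschitzOnWith K w (Ici 0))
    (hw' : ∀ t, 0 ≤ t → HasDerivWithinAt w (A (w t)) (Ici t) t) :
    ∃ q > 0, IsDissipatedBy q K 0 (fun t => ⟪w t, P (w t)⟫) w := by
  obtain ⟨p, hp, hpP⟩ := hP.exists_mul_norm_sq_le
  obtain ⟨q, hq, hqA⟩ := hP.exists_two_mul_inner_le
  have hcont := hw.continuousOn
  refine ⟨q, hq,
    { nonneg := fun t _ => le_trans (by positivity) (hpP (w t))
      continuousOn := hcont.inner (𝕜 := ℝ) (P.continuous.comp_continuousOn hcont)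
      exists_deriv_le := fun t ht => ⟨_, ?_, hqA (w t)⟩
      lipschitzOnWith := hw }⟩
  have hwt := hw' t ht
  refine (hwt.inner ℝ (P.hasFDerivAt.comp_hasDerivWithinAt t hwt)).congr_deriv ?_
  have hsymm : ⟪w t, P (A (w t))⟫ = ⟪P (w t), A (w t)⟫ := (hP.isSymmetric (w t) (A (w t))).symm
  rw [Function.comp_apply, hsymm, real_inner_comm (P (w t)), two_mul]

/- Without input the quadratic form of `P` can pay for only finitely many windows in which `w` is
not small. -/
theorem IsExciting.input_ne_zero [Nontrivial H] {T α : ℝ} {ρ : ℝ → ℝ} (hexc : IsExciting T α w)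
    (hT : 0 < T) (hα : 0 < α) (hP : IsLyapunovOperator A P) (hw : LipschitzOnWith K w (Ici 0))
    (hw' : ∀ t, 0 ≤ t → HasDerivWithinAt w (A (w t) + ρ t • b) (Ici t) t) : b ≠ 0 := by
  rintro rfl
  simp only [smul_zero, add_zero] at hw'
  obtain ⟨q, hq, hdiss⟩ := hP.exists_isDissipatedBy hw hw'
  obtain ⟨_, -, hwindow⟩ := IsDissipatedBy.exists_window_forall_norm_lt (E := H) hq
    (show 0 < √(α / (2 * T)) by positivity) hT.le K ⟪w 0, P (w 0)⟫
  obtain ⟨a, ha, hsmall⟩ := hwindow 0 _ w hdiss le_rfl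
  obtain ⟨v, hv⟩ := exists_norm_eq H zero_le_one
  have hproj : ∀ τ ∈ Icc a (a + T), |⟪w τ, v⟫| ≤ √(α / (2 * T)) := fun τ hτ =>
    (abs_real_inner_le_norm _ _).trans (by rw [hv, mul_one]; exact (hsmall τ hτ).le)
  have hlow := hexc.mul_norm_sq_le hT.le ha.1 hproj
  have hhalf : α / (2 * T) * T = α / 2 := by field_simp
  rw [hv, Real.sq_sqrt (by positivity), hhalf] at hlow
  linarith

theorem uniformlyDetectable_of_subsingleton {F : Type*} [NormedAddCommGroup F] [NormedSpace ℝ F]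
    [Subsingleton E] (f : E → ℝ → E) (h : E →L[ℝ] F) : UniformlyDetectable f h :=
  fun _ _ hη => ⟨1, one_pos, 0, le_rfl, fun _ _ x₀ _ _ _ _ => by
    rw [Subsingleton.elim x₀ 0, norm_zero]
    exact hη.le⟩

theorem mainTheorem4_general {T α : ℝ} {ρ : ℝ → ℝ} (hP : IsLyapunovOperator A P)
    (hρ : BoundedSignal ρ) (hw : ContinuousOn w (Ici 0))
    (hw' : ∀ t, 0 ≤ t → HasDerivWithinAt w (A (w t) + ρ t • b) (Ici t) t)
    (hwb : BoundedSignal w) (hT : 0 < T) (hα : 0 < α) (hexc : IsExciting T α w) :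
    IsEquilibriumZero (adaptiveField A b (P b) w) ∧
      HasTransitionFunction (adaptiveField A b (P b) w) ∧ IsUASL (adaptiveField A b (P b) w) := by
  have : ProperSpace H := FiniteDimensional.proper ℝ H
  have : ProperSpace (WithLp 2 (H × H)) := FiniteDimensional.proper ℝ _
  obtain ⟨K, hwK⟩ := exists_lipschitzOnWith_of_linear_deriv_right hw hw' hwb hρ
  have hdet : UniformlyDetectable (adaptiveField A b (P b) w) (WithLp.fstL 2 ℝ H H) := by
    rcases subsingleton_or_nontrivial H with _ | _
    · have : Subsingleton (WithLp 2 (H × H)) := (WithLp.equiv 2 (H × H)).subsingleton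
      exact uniformlyDetectable_of_subsingleton _ _
    · exact uniformlyDetectable_adaptiveField hwK hwb
        (hexc.input_ne_zero hT hα hP hwK hw') hT hα hexc
  have hzero : IsEquilibriumZero (adaptiveField A b (P b) w) := isEquilibriumZero_adaptiveField
  have hlip : LipschitzOnBounded (adaptiveField A b (P b) w) :=
    lipschitzOnBounded_of_contDiff (g := adaptiveVelocity A b (P b))
      (contDiff_adaptiveVelocity A b (P b)) hwb
  obtain ⟨l, m, hV⟩ := exists_isLyapunovFunction_adaptiveEnergy (b := b) (w := w) hP
  obtain ⟨q, hq, hqA⟩ := hP.exists_two_mul_inner_le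
  refine ⟨hzero, hV.hasTransitionFunction hlip hzero fun z => ?_, hV.uniformlyStable,
    hV.uniformlyBounded, hV.uniformlyAttractingInTheLarge hlip hzero hq (fun t _ z => ?_) hdet⟩
  · exact (contDiff_adaptiveVelocity A b (P b)).continuous.comp_continuousOn
      (continuousOn_const.prodMk hw)
  · rw [fderiv_adaptiveEnergy_adaptiveField hP.isSymmetric]
    exact hqA z.fst

end ReferenceSignal

section ReferenceModel

variable {n : ℕ} {A P Q : Matrix (Fin n) (Fin n) ℝ} {B : Fin n → ℝ} {r : ℝ → ℝ}
  {xm : ℝ → EuclideanSpace ℝ (Fin n)}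

theorem two_mul_inner_toEuclideanCLM_of_lyapunov (hP : P.IsHermitian)
    (hLyap : A.transpose * P + P * A = -Q) (v : EuclideanSpace ℝ (Fin n)) :
    2 * ⟪Matrix.toEuclideanCLM (𝕜 := ℝ) P v, Matrix.toEuclideanCLM (𝕜 := ℝ) A v⟫ =
      -(v.ofLp ⬝ᵥ Q.mulVec v.ofLp) := by
  have hPA : ⟪Matrix.toEuclideanCLM (𝕜 := ℝ) P v, Matrix.toEuclideanCLM (𝕜 := ℝ) A v⟫ =
      v.ofLp ⬝ᵥ (P * A).mulVec v.ofLp := by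
    rw [← Matrix.mulVec_mulVec]
    exact (Matrix.isSymmetric_toEuclideanLin_iff.2 hP v _).trans (Matrix.inner_toEuclideanCLM P v _)
  have hAP : ⟪Matrix.toEuclideanCLM (𝕜 := ℝ) P v, Matrix.toEuclideanCLM (𝕜 := ℝ) A v⟫ =
      v.ofLp ⬝ᵥ (A.transpose * P).mulVec v.ofLp := by
    rw [Matrix.inner_toEuclideanCLM, Matrix.ofLp_toEuclideanCLM, ← Matrix.mulVec_mulVec,
      Matrix.dotProduct_mulVec v.ofLp A.transpose, Matrix.vecMul_transpose, dotProduct_comm]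
  calc 2 * ⟪Matrix.toEuclideanCLM (𝕜 := ℝ) P v, Matrix.toEuclideanCLM (𝕜 := ℝ) A v⟫
      = v.ofLp ⬝ᵥ (A.transpose * P + P * A).mulVec v.ofLp := by
        rw [Matrix.add_mulVec, dotProduct_add, ← hAP, ← hPA, two_mul]
    _ = -(v.ofLp ⬝ᵥ Q.mulVec v.ofLp) := by rw [hLyap, Matrix.neg_mulVec, dotProduct_neg]

theorem isLyapunovOperator_toEuclideanCLM (hP : P.PosDef) (hQ : Q.PosDef)
    (hLyap : A.transpose * P + P * A = -Q) :
    IsLyapunovOperator (Matrix.toEuclideanCLM (𝕜 := ℝ) A) (Matrix.toEuclideanCLM (𝕜 := ℝ) P) := by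
  have hpos : ∀ {M : Matrix (Fin n) (Fin n) ℝ}, M.PosDef → ∀ v : EuclideanSpace ℝ (Fin n),
      v ≠ 0 → 0 < v.ofLp ⬝ᵥ M.mulVec v.ofLp := fun hM v hv => by
    simpa using hM.dotProduct_mulVec_pos (x := v.ofLp) (by simpa using hv)
  refine ⟨Matrix.isSymmetric_toEuclideanLin_iff.2 hP.isHermitian, fun v hv => ?_, fun v hv => ?_⟩
  · rw [Matrix.inner_toEuclideanCLM]
    exact hpos hP v hv
  · linarith [hpos hQ v hv, two_mul_inner_toEuclideanCLM_of_lyapunov hP.isHermitian hLyap v]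

theorem PiecewiseContinuous.eventually_continuousWithinAt (hr : PiecewiseContinuous r) {t : ℝ}
    (ht : 0 ≤ t) : ∀ᶠ τ in 𝓝[>] t, ContinuousWithinAt r (Ici 0) τ := by
  have hfar : ∀ᶠ τ in 𝓝[>] t,
      τ ∉ {τ | τ ∈ Icc 0 (t + 1) ∧ ¬ ContinuousWithinAt r (Ici 0) τ} \ {t} :=
    nhdsWithin_le_nhds (((hr.1 (t + 1)).sdiff).isClosed.isOpen_compl.mem_nhds fun h => h.2 rfl)
  filter_upwards [hfar, Ioo_mem_nhdsGT (lt_add_one t)] with τ hτ hτt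
  by_contra hdisc
  exact hτ ⟨⟨⟨ht.trans hτt.1.le, hτt.2.le⟩, hdisc⟩, hτt.1.ne'⟩

theorem IsReferenceState.hasDerivWithinAt_Ici (hxm : IsReferenceState A B r xm)
    (hr : PiecewiseContinuous r) {t l : ℝ} (ht : 0 ≤ t) (hl : Tendsto r (𝓝[>] t) (𝓝 l)) :
    HasDerivWithinAt xm (Matrix.toEuclideanCLM (𝕜 := ℝ) A (xm t) + l • WithLp.toLp 2 B)
      (Ici t) t := by
  have hderiv : ∀ᶠ τ in 𝓝[>] t, HasDerivAt xm
      (Matrix.toEuclideanCLM (𝕜 := ℝ) A (xm τ) + r τ • WithLp.toLp 2 B) τ := by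
    filter_upwards [hr.eventually_continuousWithinAt ht, self_mem_nhdsWithin] with τ hτ htτ
    have hτ0 : 0 < τ := ht.trans_lt htτ
    exact (hxm.2 τ hτ0.le hτ).hasDerivAt (Ici_mem_nhds hτ0)
  have hcont : ContinuousWithinAt xm (Ioi t) t :=
    (hxm.1 t ht).mono fun τ hτ => ht.trans hτ.le
  have hlim : Tendsto (fun τ => Matrix.toEuclideanCLM (𝕜 := ℝ) A (xm τ) + r τ • WithLp.toLp 2 B)
      (𝓝[>] t) (𝓝 (Matrix.toEuclideanCLM (𝕜 := ℝ) A (xm t) + l • WithLp.toLp 2 B)) :=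
    (((Matrix.toEuclideanCLM (𝕜 := ℝ) A).continuous.tendsto _).comp hcont).add (hl.smul_const _)
  have hmem := inter_mem hderiv self_mem_nhdsWithin
  exact hasDerivWithinAt_Ici_of_tendsto_deriv
    (fun τ hτ => hτ.1.differentiableAt.differentiableWithinAt)
    (hcont.mono inter_subset_right) hmem (hlim.congr' (hderiv.mono fun τ hτ => hτ.deriv.symm))

theorem IsReferenceState.exists_boundedSignal_hasDerivWithinAt_Ici
    (hxm : IsReferenceState A B r xm) (hr : PiecewiseContinuous r) (hrb : BoundedSignal r) :
    ∃ ρ : ℝ → ℝ, BoundedSignal ρ ∧ ∀ t, 0 ≤ t → HasDerivWithinAt xm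
      (Matrix.toEuclideanCLM (𝕜 := ℝ) A (xm t) + ρ t • WithLp.toLp 2 B) (Ici t) t := by
  choose! ρ hρ using hr.2.1
  obtain ⟨γ, hγ⟩ := hrb
  refine ⟨ρ, ⟨γ, fun t ht => ?_⟩, fun t ht => hxm.hasDerivWithinAt_Ici hr ht (hρ t ht)⟩
  refine le_of_tendsto (hρ t ht).norm ?_
  filter_upwards [self_mem_nhdsWithin] with τ hτ
  exact hγ τ (ht.trans (le_of_lt hτ))

theorem dotProduct_excitationMatrix_mulVec {y : ℝ → EuclideanSpace ℝ (Fin n)} {t T : ℝ}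
    (hy : ContinuousOn y (uIcc t (t + T))) (v : EuclideanSpace ℝ (Fin n)) :
    v.ofLp ⬝ᵥ (excitationMatrix y t T).mulVec v.ofLp = ∫ τ in t..(t + T), ⟪y τ, v⟫ ^ 2 := by
  have hint : ∀ i j, IntervalIntegrable (fun τ => v i * v j * (y τ i * y τ j))
      MeasureTheory.volume t (t + T) := fun i j =>
    (continuousOn_const.mul
      (((EuclideanSpace.proj i).continuous.comp_continuousOn hy).mul
        ((EuclideanSpace.proj j).continuous.comp_continuousOn hy))).intervalIntegrable
  calc v.ofLp ⬝ᵥ (excitationMatrix y t T).mulVec v.ofLp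
      = ∑ i, ∑ j, ∫ τ in t..(t + T), v i * v j * (y τ i * y τ j) := by
        simp only [dotProduct, Matrix.mulVec, excitationMatrix, Matrix.of_apply, Finset.mul_sum,
          intervalIntegral.integral_const_mul]
        exact Finset.sum_congr rfl fun i _ => Finset.sum_congr rfl fun j _ => by ring
    _ = ∫ τ in t..(t + T), ∑ i, ∑ j, v i * v j * (y τ i * y τ j) := by
        rw [intervalIntegral.integral_finsetSum fun i _ => by
          simpa only [Finset.sum_fn] using
            IntervalIntegrable.sum Finset.univ fun j _ => hint i j]
        exact Finset.sum_congr rfl fun i _ =>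
          (intervalIntegral.integral_finsetSum fun j _ => hint i j).symm
    _ = ∫ τ in t..(t + T), ⟪y τ, v⟫ ^ 2 := by
        refine intervalIntegral.integral_congr fun τ _ => ?_
        simp only [PiLp.inner_apply, sq, Finset.sum_mul_sum, RCLike.inner_apply, conj_trivial]
        exact Finset.sum_congr rfl fun i _ => Finset.sum_congr rfl fun j _ => by ring

theorem PersistentlyExciting.exists_isExciting {y : ℝ → EuclideanSpace ℝ (Fin n)}
    (hPE : PersistentlyExciting y) (hy : ContinuousOn y (Ici 0)) :
    ∃ T > 0, ∃ α > 0, IsExciting T α y := by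
  obtain ⟨T, hT, α, hα, hpsd⟩ := hPE
  refine ⟨T, hT, α, hα, fun t ht v => ?_⟩
  have hcont : ContinuousOn y (uIcc t (t + T)) := by
    rw [uIcc_of_le (by linarith)]
    exact hy.mono fun τ hτ => ht.trans hτ.1
  have hform := (hpsd t ht).dotProduct_mulVec_nonneg v.ofLp
  simp only [star_trivial, Matrix.sub_mulVec, dotProduct_sub, Matrix.smul_mulVec,
    Matrix.one_mulVec, dotProduct_smul, smul_eq_mul] at hform
  rw [← dotProduct_excitationMatrix_mulVec hcont, EuclideanSpace.real_norm_sq_eq]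
  simpa only [dotProduct, sq, sub_nonneg] using hform

theorem ofLp_errorField (z : EuclideanSpace ℝ (Fin n ⊕ Fin n)) (t : ℝ) :
    (errorField A P B xm z t).ofLp = Sum.elim
      (A.mulVec (z ∘ Sum.inl) + (plantState xm z t ⬝ᵥ z ∘ Sum.inr) • B)
      (-((P.mulVec B ⬝ᵥ z ∘ Sum.inl) • plantState xm z t)) := by
  simp only [errorField, Matrix.fromBlocks_mulVec, Matrix.vecMulVec_mulVec, Matrix.neg_mulVec,
    Matrix.zero_mulVec, add_zero, op_smul_eq_smul]

theorem sumPiLpEquivProdLpPiLp_errorField (z : EuclideanSpace ℝ (Fin n ⊕ Fin n)) (t : ℝ) :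
    PiLp.sumPiLpEquivProdLpPiLp (𝕜 := ℝ) 2 (fun _ => ℝ) (errorField A P B xm z t) =
      adaptiveField (Matrix.toEuclideanCLM (𝕜 := ℝ) A) (WithLp.toLp 2 B)
        (Matrix.toEuclideanCLM (𝕜 := ℝ) P (WithLp.toLp 2 B)) xm
        (PiLp.sumPiLpEquivProdLpPiLp (𝕜 := ℝ) 2 (fun _ => ℝ) z) t := by
  have hinner : ∀ u v : EuclideanSpace ℝ (Fin n), ⟪u, v⟫ = u.ofLp ⬝ᵥ v.ofLp := fun u v => by
    rw [EuclideanSpace.inner_eq_star_dotProduct, star_trivial, dotProduct_comm]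
  refine (WithLp.equiv 2 _).injective (Prod.ext (PiLp.ext fun i => ?_) (PiLp.ext fun i => ?_))
  · rw [adaptiveField, adaptiveVelocity, hinner]
    exact congrFun (ofLp_errorField z t) (Sum.inl i)
  · rw [adaptiveField, adaptiveVelocity, hinner _ (WithLp.fst _)]
    exact congrFun (ofLp_errorField z t) (Sum.inr i)

end ReferenceModel

theorem mainTheorem4 (n : ℕ) (A P Q : Matrix (Fin n) (Fin n) ℝ) (B : Fin n → ℝ)
    (hA : IsHurwitz A) (hQ : Q.PosDef) (hP : P.PosDef)
    (hLyap : A.transpose * P + P * A = -Q)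
    (r : ℝ → ℝ) (hr : PiecewiseContinuous r) (hrb : BoundedSignal r)
    (xm : ℝ → EuclideanSpace ℝ (Fin n)) (hxm : IsReferenceState A B r xm)
    (hPE : PersistentlyExciting xm) (hxmb : BoundedSignal xm) :
    IsEquilibriumZero (errorField A P B xm) ∧
    HasTransitionFunction (errorField A P B xm) ∧
    IsUASL (errorField A P B xm) := by
  obtain ⟨ρ, hρ, hxm'⟩ := hxm.exists_boundedSignal_hasDerivWithinAt_Ici hr hrb
  obtain ⟨T, hT, α, hα, hexc⟩ := hPE.exists_isExciting hxm.1
  obtain ⟨hzero, htransition, huasl⟩ := mainTheorem4_general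
    (isLyapunovOperator_toEuclideanCLM hP hQ hLyap) hρ hxm.1 hxm' hxmb hT hα hexc
  have hconj := sumPiLpEquivProdLpPiLp_errorField (A := A) (P := P) (B := B) (xm := xm)
  exact ⟨isEquilibriumZero_of_conjugate _ hconj hzero,
    hasTransitionFunction_of_conjugate _ hconj htransition, isUASL_of_conjugate _ hconj huasl⟩
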